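/- Let $k$ be an algebraically closed field and let $\mathcal{A}$ be a finite ribbon category over $k$: a finite $k$-linear abelian category (finite-dimensional morphism spaces, all objects of finite length, enough projectives, finitely many simple objects up to isomorphism) with a $k$-bilinear rigid monoidal product with simple unit $I$, a braiding $c$, and a balancing $\theta$ (a natural automorphism of $\mathrm{id}_{\mathcal{A}}$ with $\theta_I=\mathrm{id}_I$ and $\theta_{X\otimes Y}=c_{Y,X}c_{X,Y}(\theta_X\otimes\theta_Y)$) satisfying $\theta_{X^\vee}=(\theta_X)^\vee$ for all $X$. An extension of $\mathcal{A}$ to a ribbon Grothendieck--Verdier category consists of an object $K$, an equivalence $D:\mathcal{A}\to\mathcal{A}^{\mathrm{op}}$ and $k$-linear isomorphisms $\mathcal{A}(K,X\otimes Y)\cong\mathcal{A}(DX,Y)$ natural in $X,Y$, such that $\theta_{DX}=D\theta_X$ for all $X$. Put $\kappa(X,Y)=\mathcal{A}(DX,Y)$ and let $\gamma_{X,Y}:\kappa(I,X\otimes Y)\cong\mathcal{A}(K,I\otimes (X\otimes Y))\cong\mathcal{A}(K,X\otimes Y)\cong\kappa(X,Y)$. Two extensions are equivalent (relative to $\mathcal{A}$)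 if there is a $k$-linear natural isomorphism $\kappa_1\cong\kappa_2$ compatible with $\gamma_1$ and $\gamma_2$. The rigid extension is the one with $K=I$, $DX=X^\vee$ and the isomorphisms $\mathcal{A}(I,X\otimes Y)\cong\mathcal{A}(X^\vee,Y)$ given by rigidity. Let $Z_2^{\mathrm{bal}}(\mathcal{A})\subset\mathcal{A}$ be the full monoidal subcategory of those objects $X$ with $c_{Y,X}c_{X,Y}=\mathrm{id}_{X\otimes Y}$ for all $Y\in\mathcal{A}$ and $\theta_X=\mathrm{id}_X$, and let $\mathrm{Pic}(Z_2^{\mathrm{bal}}(\mathcal{A}))$ be its group of isomorphism classes of invertible objects. Let $\mathrm{RibAut}(\mathcal{A})$ be the group of $k$-linear braided monoidal autoequivalences of $\mathcal{A}$ preserving $\theta$, up to monoidal natural isomorphism. For the rigid extension, let $\mathrm{cAut}(\mathcal{A})$ be the group of such autoequivalences $F$ equipped with a $k$-linear natural isomorphism $t_{X,Y}:\kappa(X,Y)\cong\kappa(FX,FY)$ compatible with $\gamma$, up to monoidal natural isomorphism compatible with the isomorphisms $t$. Both groups have composition as multiplication. (1) There is a bijection between $\mathrm{Pic}(Z_2^{\mathrm{bal}}(\mathcal{A}))$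 and the set of equivalence classes of extensions of $\mathcal{A}$ to a ribbon Grothendieck--Verdier category. It sends the neutral element to the class of the rigid extension and, in general, the class of $L$ to the class of those extensions whose dualizing object $K$ is isomorphic to $L$. (2) Let $i:\mathrm{Aut}_{\mathcal{A}}(I)\to\mathrm{cAut}(\mathcal{A})$ send $u$ to the identity functor with the isomorphism $t$ induced, via $\mathcal{A}(X^\vee,Y)\cong\mathcal{A}(I,X\otimes Y)$, by precomposition with $u^{-1}$; let $p:\mathrm{cAut}(\mathcal{A})\to\mathrm{RibAut}(\mathcal{A})$ forget $t$; and let $s:\mathrm{RibAut}(\mathcal{A})\to\mathrm{cAut}(\mathcal{A})$ equip $F$ with its canonical compatibility with the rigid duality, $\mathcal{A}(X^\vee,Y)\cong\mathcal{A}(I,X\otimes Y)\to\mathcal{A}(FI,F(X\otimes Y))\cong\mathcal{A}(I,FX\otimes FY)\cong\mathcal{A}((FX)^\vee,FY)$. Then $$1\to\mathrm{Aut}_{\mathcal{A}}(I)\xrightarrow{\,i\,}\mathrm{cAut}(\mathcal{A})\xrightarrow{\,p\,}\mathrm{RibAut}(\mathcal{A})\to 1$$ is an exact sequence of groups split by $s$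 (that is, $p\circ s=\mathrm{id}$). Consequently there is a group isomorphism $$\mathrm{cAut}(\mathcal{A})\cong\mathrm{RibAut}(\mathcal{A})\ltimes\mathrm{Aut}_{\mathcal{A}}(I)$$ that carries $i$, $s$ and $p$ to the two canonical inclusions and the canonical projection of the semidirect product. Here $F$ acts on $\mathrm{Aut}_{\mathcal{A}}(I)$ by sending $u$ to $I\cong FI\xrightarrow{Fu}FI\cong I$. -/

import Mathlib

open CategoryTheory MonoidalCategory

universe w v u

noncomputable section

namespace GV

/-! ### Finite ribbon categories -/

/-- A balancing on a braided monoidal category: a natural automorphism `θ` of the identity with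
`θ_I = id` and `θ_{X ⊗ Y} = c_{Y,X} ∘ c_{X,Y} ∘ (θ_X ⊗ θ_Y)`. -/
class BalancedCategory (A : Type u) [Category.{v} A] [MonoidalCategory A]
    [BraidedCategory A] where
  twist (X : A) : X ≅ X
  twist_naturality {X Y : A} (f : X ⟶ Y) : f ≫ (twist Y).hom = (twist X).hom ≫ f
  twist_unit : (twist (𝟙_ A)).hom = 𝟙 (𝟙_ A)
  twist_tensor (X Y : A) :
    (twist (X ⊗ Y)).hom =
      ((twist X).hom ⊗ₘ (twist Y).hom) ≫ (β_ X Y).hom ≫ (β_ Y X).hom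

/-- The component `θ_X` of the balancing. -/
abbrev θ {A : Type u} [Category.{v} A] [MonoidalCategory A] [BraidedCategory A]
    [BalancedCategory A] (X : A) : X ⟶ X :=
  (BalancedCategory.twist X).hom

/-- A finite linear category over the field `k`: a `k`-linear abelian category with
finite-dimensional morphism spaces, all of whose objects have finite length (that is, are both
noetherian and artinian), with enough projectives and with finitely many simple objects up to
isomorphism. -/
class IsFiniteLinear (k : Type w) [Field k] (A : Type u) [Category.{v} A] [Abelian A]
    [Linear k A] : Prop where
  finiteDimensional_hom (X Y : A) : FiniteDimensional k (X ⟶ Y)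
  isNoetherianObject (X : A) : IsNoetherianObject X
  isArtinianObject (X : A) : IsArtinianObject X
  enoughProjectives : EnoughProjectives A
  finite_simples : ∃ (n : ℕ) (S : Fin n → A), ∀ X : A, Simple X → ∃ i, Nonempty (X ≅ S i)

/-- A finite ribbon category over the field `k`: a finite tensor category (finite linear, rigid,
with bilinear monoidal product and simple unit), equipped with a braiding and a balancing such that
`θ_{X^∨} = (θ_X)^∨` for all `X`. -/
class IsFiniteRibbon (k : Type w) [Field k] (A : Type u) [Category.{v} A] [Abelian A]
    [Linear k A] [MonoidalCategory A] [MonoidalPreadditive A] [MonoidalLinear k A]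
    [RigidCategory A] [BraidedCategory A] [BalancedCategory A] : Prop
    extends IsFiniteLinear k A where
  simple_unit : Simple (𝟙_ A)
  twist_dual (X : A) : θ (Xᘁ) = (θ X)ᘁ

/-! ### Ribbon Grothendieck-Verdier structures -/

section Structures

variable (k : Type w) [Field k] (A : Type u) [Category.{v} A] [Preadditive A] [Linear k A]
  [MonoidalCategory A] [BraidedCategory A] [BalancedCategory A]

/-- A ribbon Grothendieck-Verdier structure on the balanced braided `k`-linear category `A`
(equivalently: an extension of `A` to a ribbon Grothendieck-Verdier category): a dualizing object
`K`, an equivalence `D : A ⥤ Aᵒᵖ`, and isomorphisms `A(K, X ⊗ Y) ≅ A(D X, Y)` natural in `X` and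
`Y`, such that `θ_{D X} = D θ_X`. -/
structure RibbonGVStructure where
  K : A
  D : A ⥤ Aᵒᵖ
  isEquivalence : D.IsEquivalence
  repr (X Y : A) : (K ⟶ X ⊗ Y) ≃ₗ[k] ((D.obj X).unop ⟶ Y)
  repr_naturality {X X' Y Y' : A} (f : X ⟶ X') (g : Y ⟶ Y') (h : K ⟶ X ⊗ Y) :
    repr X' Y' (h ≫ (f ⊗ₘ g)) = (D.map f).unop ≫ repr X Y h ≫ g
  twist_D (X : A) : θ (D.obj X).unop = (D.map (θ X)).unop

/-- A ribbon autoequivalence of `A`, i.e. an autoequivalence of the underlying balanced braided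
category: a `k`-linear braided (strong) monoidal autoequivalence preserving the balancing. -/
structure BalancedAutoequiv where
  functor : A ⥤ A
  braided : functor.Braided
  isEquivalence : functor.IsEquivalence
  additive : functor.Additive
  linear : functor.Linear k
  map_twist (X : A) : functor.map (θ X) = θ (functor.obj X)

attribute [instance] BalancedAutoequiv.braided BalancedAutoequiv.isEquivalence
  BalancedAutoequiv.additive BalancedAutoequiv.linear

end Structures

section Theory

variable {k : Type w} [Field k] {A : Type u} [Category.{v} A] [Preadditive A] [Linear k A]
  [MonoidalCategory A] [BraidedCategory A] [BalancedCategory A]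

open Functor.LaxMonoidal Functor.OplaxMonoidal

namespace RibbonGVStructure

/-- The pairing `κ(X, Y) = A(D X, Y)`. -/
abbrev Pairing (G : RibbonGVStructure k A) (X Y : A) : Type v := (G.D.obj X).unop ⟶ Y

/-- The functoriality of the pairing `κ` in both (covariant) arguments. -/
def pairingMap (G : RibbonGVStructure k A) {X X' Y Y' : A} (f : X ⟶ X') (g : Y ⟶ Y')
    (h : G.Pairing X Y) : G.Pairing X' Y' :=
  (G.D.map f).unop ≫ h ≫ g

/-- The isomorphism `γ : κ(I, X ⊗ Y) ≅ A(K, I ⊗ (X ⊗ Y)) ≅ A(K, X ⊗ Y) ≅ κ(X, Y)`. -/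
def γ (G : RibbonGVStructure k A) (X Y : A) :
    G.Pairing (𝟙_ A) (X ⊗ Y) ≃ₗ[k] G.Pairing X Y :=
  ((G.repr (𝟙_ A) (X ⊗ Y)).symm.trans
    (Linear.homCongr k (Iso.refl G.K) (λ_ (X ⊗ Y)))).trans (G.repr X Y)

theorem γ_apply (G : RibbonGVStructure k A) (X Y : A) (h : G.Pairing (𝟙_ A) (X ⊗ Y)) :
    G.γ X Y h = G.repr X Y ((G.repr _ _).symm h ≫ (λ_ (X ⊗ Y)).hom) := by
  simp [γ, Linear.homCongr_apply]

theorem pairingMap_id (G : RibbonGVStructure k A) {X Y : A} (h : G.Pairing X Y) :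
    G.pairingMap (𝟙 X) (𝟙 Y) h = h := by
  simp [pairingMap]

theorem pairingMap_comp (G : RibbonGVStructure k A) {X X' X'' Y Y' Y'' : A}
    (f : X ⟶ X') (f' : X' ⟶ X'') (g : Y ⟶ Y') (g' : Y' ⟶ Y'') (h : G.Pairing X Y) :
    G.pairingMap f' g' (G.pairingMap f g h) = G.pairingMap (f ≫ f') (g ≫ g') h := by
  simp [pairingMap]

theorem repr_map (G : RibbonGVStructure k A) {X X' Y Y' : A} (f : X ⟶ X') (g : Y ⟶ Y')
    (h : G.K ⟶ X ⊗ Y) :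
    G.repr X' Y' (h ≫ (f ⊗ₘ g)) = G.pairingMap f g (G.repr X Y h) :=
  G.repr_naturality f g h

theorem repr_symm_map (G : RibbonGVStructure k A) {X X' Y Y' : A} (f : X ⟶ X') (g : Y ⟶ Y')
    (h : G.Pairing X Y) :
    (G.repr X' Y').symm (G.pairingMap f g h) = (G.repr X Y).symm h ≫ (f ⊗ₘ g) := by
  rw [LinearEquiv.symm_apply_eq, repr_map, LinearEquiv.apply_symm_apply]

theorem γ_map (G : RibbonGVStructure k A) {X X' Y Y' : A} (f : X ⟶ X') (g : Y ⟶ Y')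
    (h : G.Pairing (𝟙_ A) (X ⊗ Y)) :
    G.γ X' Y' (G.pairingMap (𝟙 _) (f ⊗ₘ g) h) = G.pairingMap f g (G.γ X Y h) := by
  rw [γ_apply, γ_apply, repr_symm_map, ← repr_map]
  simp

/-- An equivalence of ribbon Grothendieck-Verdier structures relative to the fixed balanced braided
category `A`, i.e. one whose underlying balanced braided functor is the identity: a natural
isomorphism `t` between the pairings `κ₁` and `κ₂` that is compatible with `γ₁` and `γ₂`. -/
structure RelEquiv (G₁ G₂ : RibbonGVStructure k A) where
  t (X Y : A) : G₁.Pairing X Y ≃ₗ[k] G₂.Pairing X Y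
  t_naturality {X X' Y Y' : A} (f : X ⟶ X') (g : Y ⟶ Y') (h : G₁.Pairing X Y) :
    t X' Y' (G₁.pairingMap f g h) = G₂.pairingMap f g (t X Y h)
  t_γ (X Y : A) (h : G₁.Pairing (𝟙_ A) (X ⊗ Y)) :
    t X Y (G₁.γ X Y h) = G₂.γ X Y (t (𝟙_ A) (X ⊗ Y) h)

variable (k A) in
/-- Two ribbon Grothendieck-Verdier structures are identified if they are equivalent relative to `A`. -/
instance relSetoid : Setoid (RibbonGVStructure k A) where
  r G₁ G₂ := Nonempty (RelEquiv G₁ G₂)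
  iseqv :=
    { refl := fun G => ⟨⟨fun _ _ => LinearEquiv.refl k _, fun _ _ _ => rfl, fun _ _ _ => rfl⟩⟩
      symm := by
        rintro G₁ G₂ ⟨e⟩
        refine ⟨⟨fun X Y => (e.t X Y).symm, fun f g h => ?_, fun X Y h => ?_⟩⟩
        · rw [LinearEquiv.symm_apply_eq, e.t_naturality, LinearEquiv.apply_symm_apply]
        · rw [LinearEquiv.symm_apply_eq, e.t_γ, LinearEquiv.apply_symm_apply]
      trans := by
        rintro G₁ G₂ G₃ ⟨e⟩ ⟨e'⟩
        refine ⟨⟨fun X Y => (e.t X Y).trans (e'.t X Y), fun f g h => ?_, fun X Y h => ?_⟩⟩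
        · simp [e.t_naturality, e'.t_naturality]
        · simp [e.t_γ, e'.t_γ] }

end RibbonGVStructure

variable (k A) in
/-- The set of equivalence classes of extensions of the balanced braided category `A` to a ribbon
Grothendieck-Verdier category, relative to `A`. -/
def RibbonGVExtensions : Type (max u v) :=
  _root_.Quotient (RibbonGVStructure.relSetoid k A)

/-- The class of an extension. -/
def RibbonGVExtensions.mk (G : RibbonGVStructure k A) : RibbonGVExtensions k A :=
  _root_.Quotient.mk _ G

/-! ### The group of ribbon autoequivalences -/

namespace BalancedAutoequiv

/-- The identity autoequivalence. -/
abbrev refl : BalancedAutoequiv k A where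
  functor := 𝟭 A
  braided := inferInstance
  isEquivalence := inferInstance
  additive := inferInstance
  linear := inferInstance
  map_twist _ := rfl

/-- The composite `F ∘ G`. -/
abbrev comp (F G : BalancedAutoequiv k A) : BalancedAutoequiv k A where
  functor := G.functor ⋙ F.functor
  braided := inferInstance
  isEquivalence := inferInstance
  additive := inferInstance
  linear := inferInstance
  map_twist X := by simp [G.map_twist, F.map_twist]

theorem exists_inverse (F : BalancedAutoequiv k A) :
    ∃ (G : BalancedAutoequiv k A) (c : G.functor ⋙ F.functor ≅ 𝟭 A),
      NatTrans.IsMonoidal c.hom := by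
  obtain ⟨F, _, _, _, _, hF⟩ := F
  obtain ⟨e, rfl⟩ : ∃ e : A ≌ A, e.functor = F := ⟨F.asEquivalence, rfl⟩
  let _ : e.inverse.Monoidal := e.inverseMonoidal
  have hI : e.toAdjunction.IsMonoidal :=
    Adjunction.instIsMonoidal e.toAdjunction
  have hM : NatTrans.IsMonoidal e.counitIso.hom :=
    inferInstanceAs (NatTrans.IsMonoidal e.toAdjunction.counit)
  have hb : ∀ X Y : A, μ e.inverse X Y ≫ e.inverse.map (β_ X Y).hom =
      (β_ (e.inverse.obj X) (e.inverse.obj Y)).hom ≫ μ e.inverse Y X := by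
    intro X Y
    apply e.functor.map_injective
    have h1 := hM.tensor X Y
    have h2 := hM.tensor Y X
    simp only [Functor.comp_obj, Functor.id_obj, Functor.LaxMonoidal.comp_μ,
      Functor.LaxMonoidal.id_μ, Category.comp_id, Category.assoc] at h1 h2
    have h3 := e.counitIso.hom.naturality (β_ X Y).hom
    simp only [Functor.comp_map, Functor.id_map] at h3
    have h4 := Functor.LaxBraided.braided (F := e.functor) (e.inverse.obj X) (e.inverse.obj Y)
    rw [← cancel_mono (e.counitIso.hom.app _), ← cancel_epi (μ e.functor _ _)]
    simp only [Functor.map_comp, Category.assoc]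
    rw [reassoc_of% h4, h2, h3, reassoc_of% h1]
    exact BraidedCategory.braiding_naturality _ _
  have hadd : e.inverse.Additive := inferInstance
  have hlin : e.inverse.Linear k := inferInstance
  refine ⟨⟨e.inverse, { braided := hb }, inferInstance, hadd, hlin, fun X => ?_⟩,
    e.counitIso, hM⟩
  apply e.functor.map_injective
  have h3 := e.counitIso.hom.naturality (θ X)
  have h4 := BalancedCategory.twist_naturality (e.counitIso.hom.app X)
  simp only [Functor.comp_map, Functor.comp_obj, Functor.id_map, Functor.id_obj] at h3 h4
  rw [hF, ← cancel_mono (e.counitIso.hom.app X), h3]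
  exact h4

variable (k A) in
/-- Two balanced braided autoequivalences are identified if they are isomorphic through a
monoidal natural isomorphism. -/
instance setoid : Setoid (BalancedAutoequiv k A) where
  r F G := ∃ e : F.functor ≅ G.functor, NatTrans.IsMonoidal e.hom
  iseqv :=
    { refl := fun F => ⟨Iso.refl _, inferInstanceAs (NatTrans.IsMonoidal (𝟙 F.functor))⟩
      symm := by
        rintro F G ⟨e, he⟩
        exact ⟨e.symm, inferInstanceAs (NatTrans.IsMonoidal e.inv)⟩
      trans := by
        rintro F G H ⟨e, he⟩ ⟨e', he'⟩
        exact ⟨e ≪≫ e', inferInstanceAs (NatTrans.IsMonoidal (e.hom ≫ e'.hom))⟩ }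

end BalancedAutoequiv

variable (k A) in
/-- The group `RibAut(A)` of isomorphism classes of ribbon (i.e. balanced braided) autoequivalences,
with composition `[F] * [G] = [F ∘ G]`. -/
def RibAut : Type (max u v) :=
  _root_.Quotient (BalancedAutoequiv.setoid k A)

namespace RibAut

/-- The class of an autoequivalence. -/
def mk (F : BalancedAutoequiv k A) : RibAut k A := _root_.Quotient.mk _ F

instance : Mul (RibAut k A) where
  mul := _root_.Quotient.map₂ BalancedAutoequiv.comp (by
    rintro F F' ⟨e, he⟩ G G' ⟨e', he'⟩
    exact ⟨NatIso.hcomp e' e, inferInstanceAs (NatTrans.IsMonoidal (e'.hom ◫ e.hom))⟩)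

theorem mk_mul (F G : BalancedAutoequiv k A) : mk F * mk G = mk (F.comp G) := rfl

instance : One (RibAut k A) where
  one := mk BalancedAutoequiv.refl

theorem exists_mul_eq_one (x : RibAut k A) : ∃ y : RibAut k A, x * y = 1 := by
  obtain ⟨F, rfl⟩ := _root_.Quotient.exists_rep x
  obtain ⟨G, c, hc⟩ := F.exists_inverse
  exact ⟨mk G, _root_.Quotient.sound ⟨c, hc⟩⟩

instance : Inv (RibAut k A) where
  inv x := (exists_mul_eq_one x).choose

instance : Group (RibAut k A) :=
  Group.ofRightAxioms
    (by
      rintro ⟨F⟩ ⟨G⟩ ⟨H⟩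
      exact _root_.Quotient.sound ⟨(Functor.associator H.functor G.functor F.functor).symm,
        inferInstanceAs (NatTrans.IsMonoidal
          (Functor.associator H.functor G.functor F.functor).inv)⟩)
    (by
      rintro ⟨F⟩
      exact _root_.Quotient.sound ⟨F.functor.leftUnitor,
        inferInstanceAs (NatTrans.IsMonoidal F.functor.leftUnitor.hom)⟩)
    (fun x => (exists_mul_eq_one x).choose_spec)

/-- The action of `F` on `Aut(I)`: the automorphism `u` is sent to the composite
`I ≅ F I → F I ≅ I` whose middle map is `F u`. -/
def unitConj (F : BalancedAutoequiv k A) : MulAut (Aut (𝟙_ A)) :=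
  (Functor.FullyFaithful.ofFullyFaithful F.functor).autMulEquivOfFullyFaithful (𝟙_ A) |>.trans
    (Functor.Monoidal.εIso F.functor).symm.conjAut

theorem unitConj_hom (F : BalancedAutoequiv k A) (u : Aut (𝟙_ A)) :
    (unitConj F u).hom = ε F.functor ≫ F.functor.map u.hom ≫ η F.functor := by
  simp [unitConj, Functor.FullyFaithful.autMulEquivOfFullyFaithful, Iso.conjAut_hom,
    Iso.conj_apply]
  rfl

theorem unitConj_congr {F G : BalancedAutoequiv k A} (h : F ≈ G) : unitConj F = unitConj G := by
  obtain ⟨e, he⟩ := h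
  ext u
  have h1 := he.unit
  have h2 : e.hom.app (𝟙_ A) ≫ η G.functor = η F.functor := by
    rw [← cancel_epi (ε F.functor), reassoc_of% h1, Functor.Monoidal.ε_η,
      Functor.Monoidal.ε_η]
  rw [unitConj_hom, unitConj_hom, ← h1, ← h2]
  simp

/-- The action of `RibAut(A)` on `Aut(I)` by group automorphisms. -/
def unitAction : RibAut k A →* MulAut (Aut (𝟙_ A)) where
  toFun := _root_.Quotient.lift unitConj (fun _ _ h => unitConj_congr h)
  map_one' := by
    ext u
    change (unitConj BalancedAutoequiv.refl u).hom = u.hom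
    rw [unitConj_hom]
    simp
  map_mul' := by
    rintro ⟨F⟩ ⟨G⟩
    ext u
    change (unitConj (F.comp G) u).hom = (unitConj F (unitConj G u)).hom
    simp only [unitConj_hom]
    simp

theorem unitAction_mk (F : BalancedAutoequiv k A) : unitAction (mk F) = unitConj F := rfl

end RibAut

/-! ### Cyclic autoequivalences -/

/-- A cyclic autoequivalence of the ribbon Grothendieck-Verdier category `(A, G)`: a balanced braided
autoequivalence `F` together with a natural isomorphism `κ(X, Y) ≅ κ(F X, F Y)` compatible with
the isomorphisms `γ : κ(I, X ⊗ Y) ≅ κ(X, Y)`. -/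
structure CyclicAutoequiv (G : RibbonGVStructure k A) extends BalancedAutoequiv k A where
  t (X Y : A) : G.Pairing X Y ≃ₗ[k] G.Pairing (functor.obj X) (functor.obj Y)
  t_naturality {X X' Y Y' : A} (f : X ⟶ X') (g : Y ⟶ Y') (h : G.Pairing X Y) :
    t X' Y' (G.pairingMap f g h) = G.pairingMap (functor.map f) (functor.map g) (t X Y h)
  t_γ (X Y : A) (h : G.Pairing (𝟙_ A) (X ⊗ Y)) :
    t X Y (G.γ X Y h) =
      G.γ (functor.obj X) (functor.obj Y)
        (G.pairingMap (η functor) (δ functor X Y) (t (𝟙_ A) (X ⊗ Y) h))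

namespace CyclicAutoequiv

variable {G : RibbonGVStructure k A}

variable (G) in
/-- The identity. -/
abbrev refl : CyclicAutoequiv G where
  toBalancedAutoequiv := BalancedAutoequiv.refl
  t _ _ := LinearEquiv.refl k _
  t_naturality _ _ _ := rfl
  t_γ X Y h := congrArg (G.γ X Y) (G.pairingMap_id h).symm

/-- The composite `Φ ∘ Ψ`. -/
abbrev comp (Φ Ψ : CyclicAutoequiv G) : CyclicAutoequiv G where
  toBalancedAutoequiv := Φ.toBalancedAutoequiv.comp Ψ.toBalancedAutoequiv
  t X Y := (Ψ.t X Y).trans (Φ.t (Ψ.functor.obj X) (Ψ.functor.obj Y))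
  t_naturality f g h := by
    simp only [LinearEquiv.trans_apply, Ψ.t_naturality, Φ.t_naturality]
    rfl
  t_γ X Y h := by
    simp only [LinearEquiv.trans_apply, Ψ.t_γ, Φ.t_γ, Φ.t_naturality,
      RibbonGVStructure.pairingMap_comp]
    rfl

theorem comp_t (Φ Ψ : CyclicAutoequiv G) (X Y : A) (h : G.Pairing X Y) :
    (Φ.comp Ψ).t X Y h = Φ.t _ _ (Ψ.t X Y h) := rfl

variable (G) in
/-- Two cyclic autoequivalences are identified if they are isomorphic through a
monoidal natural isomorphism that is compatible with the isomorphisms of pairings. -/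
instance setoid : Setoid (CyclicAutoequiv G) where
  r Φ Ψ := ∃ e : Φ.functor ≅ Ψ.functor, NatTrans.IsMonoidal e.hom ∧
    ∀ (X Y : A) (h : G.Pairing X Y),
      Ψ.t X Y h = G.pairingMap (e.hom.app X) (e.hom.app Y) (Φ.t X Y h)
  iseqv :=
    { refl := fun Φ => ⟨Iso.refl _, inferInstanceAs (NatTrans.IsMonoidal (𝟙 Φ.functor)),
        fun X Y h => (G.pairingMap_id _).symm⟩
      symm := by
        rintro Φ Ψ ⟨e, he, ht⟩
        refine ⟨e.symm, inferInstanceAs (NatTrans.IsMonoidal e.inv), fun X Y h => ?_⟩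
        rw [ht, G.pairingMap_comp]
        simp [G.pairingMap_id]
      trans := by
        rintro Φ Ψ Ξ ⟨e, he, ht⟩ ⟨e', he', ht'⟩
        refine ⟨e ≪≫ e', inferInstanceAs (NatTrans.IsMonoidal (e.hom ≫ e'.hom)),
          fun X Y h => ?_⟩
        rw [ht', ht, G.pairingMap_comp]
        rfl }

theorem exists_inverse (Φ : CyclicAutoequiv G) : ∃ Ψ : CyclicAutoequiv G, Φ.comp Ψ ≈ refl G := by
  obtain ⟨F', c, hc⟩ := Φ.toBalancedAutoequiv.exists_inverse
  let t' (X Y : A) : G.Pairing X Y ≃ₗ[k] G.Pairing (F'.functor.obj X) (F'.functor.obj Y) :=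
    (LinearEquiv.ofBijective
      { toFun := G.pairingMap (c.inv.app X) (c.inv.app Y)
        map_add' := fun h h' => by simp [RibbonGVStructure.pairingMap]
        map_smul' := fun a h => by simp [RibbonGVStructure.pairingMap] }
      (Function.bijective_iff_has_inverse.mpr
        ⟨G.pairingMap (c.hom.app X) (c.hom.app Y),
          fun h => by
            change G.pairingMap _ _ (G.pairingMap _ _ h) = h
            rw [G.pairingMap_comp]
            simp [G.pairingMap_id],
          fun h => by
            change G.pairingMap _ _ (G.pairingMap _ _ h) = h
            rw [G.pairingMap_comp]
            simp [G.pairingMap_id]⟩)).trans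
      (Φ.t (F'.functor.obj X) (F'.functor.obj Y)).symm
  have ht' (X Y : A) (h : G.Pairing X Y) :
      Φ.t _ _ (t' X Y h) = G.pairingMap (c.inv.app X) (c.inv.app Y) h := by
    simp only [t', LinearEquiv.trans_apply, LinearEquiv.apply_symm_apply]
    rfl
  have hη : c.inv.app (𝟙_ A) ≫ Φ.functor.map (η F'.functor) ≫ η Φ.functor = 𝟙 _ := by
    have h1 := hc.unit
    simp only [Functor.LaxMonoidal.comp_ε, Functor.id_obj, Functor.comp_obj,
      Functor.LaxMonoidal.id_ε, Category.assoc] at h1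
    rw [← cancel_epi (c.hom.app (𝟙_ A))]
    rw [← cancel_epi (Φ.functor.map (ε F'.functor)), ← cancel_epi (ε Φ.functor)]
    simp [h1]
  have hδ (X Y : A) : c.inv.app (X ⊗ Y) ≫ Φ.functor.map (δ F'.functor X Y) ≫
      δ Φ.functor _ _ = c.inv.app X ⊗ₘ c.inv.app Y := by
    have h1 := hc.tensor X Y
    simp only [Functor.LaxMonoidal.comp_μ, Functor.id_obj, Functor.comp_obj,
      Functor.LaxMonoidal.id_μ, Category.assoc, Category.comp_id] at h1
    have h2 : c.inv.app (X ⊗ Y) = (c.inv.app X ⊗ₘ c.inv.app Y) ≫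
        μ Φ.functor _ _ ≫ Φ.functor.map (μ F'.functor X Y) := by
      rw [← cancel_mono (c.hom.app (X ⊗ Y))]
      simp [h1]
    rw [h2]
    simp [← Functor.map_comp_assoc]
  refine ⟨⟨F', t', fun f g h => ?_, fun X Y h => ?_⟩, c, hc, fun X Y h => ?_⟩
  · apply (Φ.t _ _).injective
    rw [Φ.t_naturality, ht', ht', G.pairingMap_comp, G.pairingMap_comp]
    have h1 := c.inv.naturality f
    have h2 := c.inv.naturality g
    simp only [Functor.id_map, Functor.comp_map] at h1 h2
    rw [h1, h2]
  · apply (Φ.t _ _).injective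
    rw [Φ.t_γ, Φ.t_naturality, ht', ht', G.pairingMap_comp, G.pairingMap_comp, hη, hδ]
    exact (G.γ_map _ _ h).symm
  · rw [comp_t]
    dsimp only
    rw [ht', G.pairingMap_comp]
    simp [G.pairingMap_id]

end CyclicAutoequiv

/-- The group `cAut(A)` of isomorphism classes of cyclic autoequivalences of the ribbon
Grothendieck-Verdier category `(A, G)`, with composition `[Φ] * [Ψ] = [Φ ∘ Ψ]`. -/
def CAut (G : RibbonGVStructure k A) : Type (max u v) :=
  _root_.Quotient (CyclicAutoequiv.setoid G)

namespace CAut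

variable {G : RibbonGVStructure k A}

/-- The class of a cyclic autoequivalence. -/
def mk (Φ : CyclicAutoequiv G) : CAut G := _root_.Quotient.mk _ Φ

instance : Mul (CAut G) where
  mul := _root_.Quotient.map₂ CyclicAutoequiv.comp (by
    rintro Φ Φ' ⟨e, he, ht⟩ Ψ Ψ' ⟨e', he', ht'⟩
    refine ⟨NatIso.hcomp e' e, inferInstanceAs (NatTrans.IsMonoidal (e'.hom ◫ e.hom)),
      fun X Y h => ?_⟩
    rw [CyclicAutoequiv.comp_t, CyclicAutoequiv.comp_t, ht, ht', Φ.t_naturality,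
      G.pairingMap_comp]
    simp)

theorem mk_mul (Φ Ψ : CyclicAutoequiv G) : mk Φ * mk Ψ = mk (Φ.comp Ψ) := rfl

instance : One (CAut G) where
  one := mk (CyclicAutoequiv.refl G)

theorem exists_mul_eq_one (x : CAut G) : ∃ y : CAut G, x * y = 1 := by
  obtain ⟨Φ, rfl⟩ := _root_.Quotient.exists_rep x
  obtain ⟨Ψ, h⟩ := Φ.exists_inverse
  exact ⟨mk Ψ, _root_.Quotient.sound h⟩

instance : Inv (CAut G) where
  inv x := (exists_mul_eq_one x).choose

instance : Group (CAut G) :=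
  Group.ofRightAxioms
    (by
      rintro ⟨Φ⟩ ⟨Ψ⟩ ⟨Ξ⟩
      exact _root_.Quotient.sound
        ⟨(Functor.associator Ξ.functor Ψ.functor Φ.functor).symm,
          inferInstanceAs (NatTrans.IsMonoidal
            (Functor.associator Ξ.functor Ψ.functor Φ.functor).inv),
          fun X Y h => (G.pairingMap_id _).symm⟩)
    (by
      rintro ⟨Φ⟩
      exact _root_.Quotient.sound ⟨Φ.functor.leftUnitor,
        inferInstanceAs (NatTrans.IsMonoidal Φ.functor.leftUnitor.hom),
        fun X Y h => (G.pairingMap_id _).symm⟩)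
    (fun x => (exists_mul_eq_one x).choose_spec)

variable (G) in
/-- The group homomorphism `cAut(A) → RibAut(A)` forgetting the compatibility with the pairing. -/
def forget : CAut G →* RibAut k A where
  toFun := _root_.Quotient.lift (fun Φ => RibAut.mk Φ.toBalancedAutoequiv) (by
    rintro Φ Ψ ⟨e, he, _⟩
    exact _root_.Quotient.sound ⟨e, he⟩)
  map_one' := rfl
  map_mul' := by
    rintro ⟨Φ⟩ ⟨Ψ⟩
    rfl

end CAut

/-! ### Cyclic autoequivalences from isomorphisms `K ≅ F K` -/

namespace CyclicAutoequiv

/-- For `j : K ≅ F K`, the isomorphism of pairings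
`A(D X, Y) ≅ A(K, X ⊗ Y) ≅ A(F K, F (X ⊗ Y)) ≅ A(K, F X ⊗ F Y) ≅ A(D F X, F Y)`. -/
def pairingIso (G : RibbonGVStructure k A) (F : BalancedAutoequiv k A)
    (j : G.K ≅ F.functor.obj G.K) (X Y : A) :
    G.Pairing X Y ≃ₗ[k] G.Pairing (F.functor.obj X) (F.functor.obj Y) :=
  (((G.repr X Y).symm.trans
    (LinearEquiv.ofBijective (F.functor.mapLinearMap k)
      ((Functor.FullyFaithful.ofFullyFaithful F.functor).map_bijective _ _))).trans
    (Linear.homCongr k j.symm (Functor.Monoidal.μIso F.functor X Y).symm)).trans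
    (G.repr (F.functor.obj X) (F.functor.obj Y))

theorem pairingIso_apply (G : RibbonGVStructure k A) (F : BalancedAutoequiv k A)
    (j : G.K ≅ F.functor.obj G.K) (X Y : A) (h : G.Pairing X Y) :
    pairingIso G F j X Y h =
      G.repr _ _ (j.hom ≫ F.functor.map ((G.repr X Y).symm h) ≫ δ F.functor X Y) := by
  rw [← Category.assoc]
  rfl

/-- A balanced braided autoequivalence `F` and an isomorphism `j : K ≅ F K` define a cyclic
autoequivalence. -/
def ofIso (G : RibbonGVStructure k A) (F : BalancedAutoequiv k A)
    (j : G.K ≅ F.functor.obj G.K) : CyclicAutoequiv G where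
  toBalancedAutoequiv := F
  t := pairingIso G F j
  t_naturality f g h := by
    rw [pairingIso_apply, pairingIso_apply, ← G.repr_map, G.repr_symm_map]
    simp [Functor.OplaxMonoidal.δ_natural]
  t_γ X Y h := by
    rw [pairingIso_apply, pairingIso_apply, G.γ_apply, G.γ_apply, ← G.repr_map]
    simp only [LinearEquiv.symm_apply_apply]
    have h1 : F.functor.map (λ_ (X ⊗ Y)).hom ≫ δ F.functor X Y =
        δ F.functor (𝟙_ A) (X ⊗ Y) ≫ (η F.functor ⊗ₘ δ F.functor X Y) ≫
          (λ_ (F.functor.obj X ⊗ F.functor.obj Y)).hom := by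
      rw [MonoidalCategory.tensorHom_def]
      simp
    simp [h1]

theorem mk_ofIso_mul (G : RibbonGVStructure k A) (F F' : BalancedAutoequiv k A)
    (j : G.K ≅ F.functor.obj G.K) (j' : G.K ≅ F'.functor.obj G.K) :
    CAut.mk (ofIso G F j) * CAut.mk (ofIso G F' j') =
      CAut.mk (ofIso G (F.comp F') (j ≪≫ F.functor.mapIso j')) := by
  refine _root_.Quotient.sound ⟨Iso.refl _, inferInstanceAs (NatTrans.IsMonoidal (𝟙 _)), ?_⟩
  intro X Y h
  refine Eq.trans ?_ (G.pairingMap_id _).symm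
  change pairingIso G (F.comp F') _ X Y h =
    pairingIso G F j _ _ (pairingIso G F' j' X Y h)
  rw [pairingIso_apply, pairingIso_apply, pairingIso_apply]
  simp

theorem mk_ofIso_congr (G : RibbonGVStructure k A) (F F' : BalancedAutoequiv k A)
    (j : G.K ≅ F.functor.obj G.K) (j' : G.K ≅ F'.functor.obj G.K)
    (e : F.functor ≅ F'.functor) (he : NatTrans.IsMonoidal e.hom)
    (hj : j.hom ≫ e.hom.app G.K = j'.hom) :
    CAut.mk (ofIso G F j) = CAut.mk (ofIso G F' j') := by
  refine _root_.Quotient.sound ⟨e, he, ?_⟩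
  intro X Y h
  change pairingIso G F' j' X Y h =
    G.pairingMap (X := F.functor.obj X) (X' := F'.functor.obj X) (Y := F.functor.obj Y)
      (Y' := F'.functor.obj Y) (e.hom.app X) (e.hom.app Y) (pairingIso G F j X Y h)
  rw [pairingIso_apply, pairingIso_apply, ← G.repr_map]
  have h1 : e.hom.app (X ⊗ Y) ≫ δ F'.functor X Y =
      δ F.functor X Y ≫ (e.hom.app X ⊗ₘ e.hom.app Y) := by
    have h2 := he.tensor X Y
    rw [← cancel_epi (μ F.functor X Y), reassoc_of% h2]
    simp
  simp [← hj, ← h1]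

theorem mk_ofIso_refl (G : RibbonGVStructure k A) :
    CAut.mk (ofIso G BalancedAutoequiv.refl (Iso.refl _)) = 1 := by
  refine _root_.Quotient.sound ⟨Iso.refl _, inferInstanceAs (NatTrans.IsMonoidal (𝟙 _)), ?_⟩
  intro X Y h
  refine Eq.trans ?_ (G.pairingMap_id _).symm
  change h = pairingIso G BalancedAutoequiv.refl _ X Y h
  rw [pairingIso_apply]
  simp

end CyclicAutoequiv

/-! ### The balanced Müger center and the Picard group -/

variable (A) in
/-- The objects of the balanced Müger center `Z₂^bal(A)`: the objects `X` that are transparent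
(the double braiding of `X` with every object is trivial) and have trivial balancing. -/
def balancedMugerCenter : ObjectProperty A := fun X =>
  (∀ Y : A, (β_ X Y).hom ≫ (β_ Y X).hom = 𝟙 (X ⊗ Y)) ∧ θ X = 𝟙 X

instance : (balancedMugerCenter A).IsMonoidal where
  prop_unit := ⟨fun Y => by simp [braiding_tensorUnit_left, braiding_tensorUnit_right],
    BalancedCategory.twist_unit⟩
  prop_tensor X Y hX hY := by
    refine ⟨fun Z => ?_, ?_⟩
    · have h1 : X ◁ (β_ Y Z).hom ≫ X ◁ (β_ Z Y).hom = 𝟙 _ := by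
        rw [← MonoidalCategory.whiskerLeft_comp, hY.1 Z, MonoidalCategory.whiskerLeft_id]
      have h2 : (β_ X Z).hom ▷ Y ≫ (β_ Z X).hom ▷ Y = 𝟙 _ := by
        rw [← comp_whiskerRight, hX.1 Z, id_whiskerRight]
      simp [BraidedCategory.braiding_tensor_left_hom, BraidedCategory.braiding_tensor_right_hom,
        reassoc_of% h1, reassoc_of% h2]
    · have h := BalancedCategory.twist_tensor X Y
      rw [hX.1 Y] at h
      simpa [hX.2, hY.2] using h

/-- The Picard group of a monoidal category: the group of isomorphism classes of invertible objects,
i.e. the units of the monoid of isomorphism classes of objects. -/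
abbrev Pic (C : Type u) [Category.{v} C] [MonoidalCategory C] : Type u := (Skeleton C)ˣ

variable (A) in
/-- The full monoidal subcategory `Z₂^bal(A)`. -/
abbrev BalancedMugerCenter : Type u := (balancedMugerCenter A).FullSubcategory

end Theory

/-! ### The rigid Grothendieck-Verdier structure -/

section Rigid

variable (k : Type w) [Field k] (A : Type u) [Category.{v} A] [Abelian A] [Linear k A]
  [MonoidalCategory A] [MonoidalPreadditive A] [MonoidalLinear k A] [RigidCategory A]
  [BraidedCategory A] [BalancedCategory A]

/-- The rigid duality functor `X ↦ X^∨`. -/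
abbrev dualFunctor : A ⥤ Aᵒᵖ where
  obj X := Opposite.op (Xᘁ)
  map f := (fᘁ).op
  map_id X := by simp
  map_comp f g := by simp [comp_rightAdjointMate]

instance : (dualFunctor A).IsEquivalence where
  faithful :=
    { map_injective := fun {X Y f g} h => by
        have h' : fᘁ = gᘁ := congrArg Quiver.Hom.unop h
        have h1 := coevaluation_comp_rightAdjointMate f
        rw [h', coevaluation_comp_rightAdjointMate g] at h1
        have h2 := congrArg (tensorRightHomEquiv (𝟙_ A) X (Xᘁ) Y).symm h1
        rw [tensorRightHomEquiv_symm_coevaluation_comp_whiskerRight,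
          tensorRightHomEquiv_symm_coevaluation_comp_whiskerRight, cancel_epi] at h2
        exact h2.symm }
  full :=
    { map_surjective := fun {X Y} h => by
        let f : X ⟶ Y := (λ_ X).inv ≫
          (tensorRightHomEquiv (𝟙_ A) X (Xᘁ) Y).symm (η_ Y (Yᘁ) ≫ Y ◁ h.unop)
        refine ⟨f, Quiver.Hom.unop_inj ?_⟩
        change fᘁ = h.unop
        have h1 : (tensorRightHomEquiv (𝟙_ A) X (Xᘁ) Y).symm (η_ X (Xᘁ) ≫ f ▷ Xᘁ) =
            (tensorRightHomEquiv (𝟙_ A) X (Xᘁ) Y).symm (η_ Y (Yᘁ) ≫ Y ◁ h.unop) := by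
          rw [tensorRightHomEquiv_symm_coevaluation_comp_whiskerRight]
          simp [f]
        have h2 := (tensorRightHomEquiv (𝟙_ A) X (Xᘁ) Y).symm.injective h1
        rw [← coevaluation_comp_rightAdjointMate] at h2
        have h3 := congrArg (tensorLeftHomEquiv (𝟙_ A) Y (Yᘁ) (Xᘁ)).symm h2
        rw [tensorLeftHomEquiv_symm_coevaluation_comp_whiskerLeft,
          tensorLeftHomEquiv_symm_coevaluation_comp_whiskerLeft, cancel_epi] at h3
        exact h3 }
  essSurj :=
    { mem_essImage := fun Y =>
        ⟨(ᘁ(Y.unop)),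
          ⟨(rightDualIso HasLeftDual.exact
            (RightRigidCategory.rightDual (HasLeftDual.leftDual Y.unop)).exact).op⟩⟩ }

/-- The isomorphism `A(I, X ⊗ Y) ≅ A(X^∨, Y)`, whose inverse sends `f` to
`(id_X ⊗ f) ∘ coev_X`. -/
def dualHomEquiv (X Y : A) : (𝟙_ A ⟶ X ⊗ Y) ≃ₗ[k] ((Xᘁ : A) ⟶ Y) :=
  LinearEquiv.symm
    { toFun := fun f => η_ X (Xᘁ) ≫ X ◁ f
      invFun := fun p => (ρ_ (Xᘁ)).inv ≫ (tensorLeftHomEquiv (𝟙_ A) X (Xᘁ) Y).symm p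
      map_add' := fun f g => by simp
      map_smul' := fun a f => by simp
      left_inv := fun f => by simp
      right_inv := fun p => by
        apply (tensorLeftHomEquiv (𝟙_ A) X (Xᘁ) Y).symm.injective
        change (tensorLeftHomEquiv (𝟙_ A) X (Xᘁ) Y).symm (η_ X (Xᘁ) ≫ X ◁ _) = _
        rw [tensorLeftHomEquiv_symm_coevaluation_comp_whiskerLeft]
        simp }

/-- The Grothendieck-Verdier structure on a finite ribbon category given by the rigid duality: the
dualizing object is the monoidal unit and `D X = X^∨`. -/
abbrev rigidStructure [IsFiniteRibbon k A] : RibbonGVStructure k A where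
  K := 𝟙_ A
  D := dualFunctor A
  isEquivalence := inferInstance
  repr := dualHomEquiv k A
  repr_naturality {X X' Y Y'} f g p := by
    obtain ⟨q, rfl⟩ := (dualHomEquiv k A X Y).symm.surjective p
    rw [← LinearEquiv.eq_symm_apply, LinearEquiv.apply_symm_apply]
    change (η_ X (Xᘁ) ≫ X ◁ q) ≫ (f ⊗ₘ g) = η_ X' (X'ᘁ) ≫ X' ◁ ((fᘁ) ≫ q ≫ g)
    rw [MonoidalCategory.whiskerLeft_comp, coevaluation_comp_rightAdjointMate_assoc,
      MonoidalCategory.tensorHom_def, Category.assoc, whisker_exchange_assoc]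
    simp
  twist_D X := IsFiniteRibbon.twist_dual k X

variable [IsFiniteRibbon k A]

/-- The canonical homomorphism `Aut(I) → cAut(A)`: the automorphism `u` is sent to the identity
functor with the automorphism of the pairing `A(X^∨, Y) ≅ A(I, X ⊗ Y)` given by precomposition
with `u⁻¹`. -/
def unitToCAut : Aut (𝟙_ A) →* CAut (rigidStructure k A) where
  toFun u := CAut.mk (CyclicAutoequiv.ofIso (rigidStructure k A) BalancedAutoequiv.refl u.symm)
  map_one' := CyclicAutoequiv.mk_ofIso_refl _
  map_mul' u u' := by
    refine Eq.trans ?_ (CyclicAutoequiv.mk_ofIso_mul _ _ _ _ _).symm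
    refine CyclicAutoequiv.mk_ofIso_congr _ _ _ _ _ (𝟭 A).leftUnitor.symm
      (inferInstanceAs (NatTrans.IsMonoidal (𝟭 A).leftUnitor.inv)) ?_
    simp [Aut.Aut_mul_def]
    rfl

/-- The canonical section `RibAut(A) → cAut(A)`: a ribbon autoequivalence `F` preserves the unit and
the duality canonically, namely through
`A(X^∨, Y) ≅ A(I, X ⊗ Y) → A(F I, F (X ⊗ Y)) ≅ A(I, F X ⊗ F Y) ≅ A((F X)^∨, F Y)`. -/
def ribSection : RibAut k A →* CAut (rigidStructure k A) where
  toFun := _root_.Quotient.lift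
    (fun F => CAut.mk (CyclicAutoequiv.ofIso (rigidStructure k A) F
      (Functor.Monoidal.εIso F.functor)))
    (by
      rintro F F' ⟨e, he⟩
      exact CyclicAutoequiv.mk_ofIso_congr _ _ _ _ _ e he he.unit)
  map_one' := CyclicAutoequiv.mk_ofIso_refl _
  map_mul' := by
    rintro ⟨F⟩ ⟨F'⟩
    refine Eq.trans ?_ (CyclicAutoequiv.mk_ofIso_mul _ F F' _ _).symm
    change CAut.mk (CyclicAutoequiv.ofIso (rigidStructure k A) (F.comp F') _) = _
    congr 2

end Rigid

end GV

end

/-! Everything rests on the Yoneda lemma. Through `repr`, the pairing κ(X, Y) becomes A(K, X ⊗ Y),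
and γ becomes composition with the left unitor. A natural isomorphism of pairings compatible with γ
is therefore determined by its values at first argument I. There it is a natural isomorphism A(K₁,
Y) ≅ A(K₂, Y), that is, an isomorphism K₁ ≅ K₂. Conversely, each such isomorphism induces an
equivalence (`relEquivOfIso`). So extensions are classified by their dualizing objects.

It remains to find which K occur. Rigidity gives A(K, X ⊗ Y) ≅ A(X^∨ ⊗ K, Y), so D X ≅ X^∨ ⊗ K
(`dualIso`). Since D is an equivalence, K is invertible. Since every object is a dual, the condition
θ_{DX} = D θ_X says θ_{Y ⊗ K} = θ_Y ⊗ id for all Y. By the balancing formula this means that θ_K and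
all double braidings with K are trivial (`K_mem_balancedMugerCenter`). Conversely, an invertible L
in the balanced Müger center yields an extension with D X = X^∨ ⊗ L (`structureOfInvertible`).

The same argument shows that the compatibilities of an autoequivalence F with the pairing correspond
to isomorphisms j : K ≅ F K (`exists_t_eq_pairingIso`). For K = I they form a torsor under Aut(I),
with the unit constraint of F as canonical point. This gives the sequence and its splitting; the
relation i(F · u) s(F) = s(F) i(u) identifies the semidirect product. -/

namespace GV

open Functor.LaxMonoidal Functor.OplaxMonoidal

/-! ### Yoneda arguments for Grothendieck-Verdier structures -/

section Structures

variable {k : Type w} [Field k] {A : Type u} [Category.{v} A] [Preadditive A] [Linear k A]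
  [MonoidalCategory A] [BraidedCategory A] [BalancedCategory A]

namespace RibbonGVStructure

/-- An isomorphism of dualizing objects induces an equivalence of ribbon Grothendieck-Verdier
structures. -/
def relEquivOfIso {G₁ G₂ : RibbonGVStructure k A} (j : G₁.K ≅ G₂.K) : RelEquiv G₁ G₂ where
  t X Y := ((G₁.repr X Y).symm.trans (Linear.homCongr k j (Iso.refl _))).trans (G₂.repr X Y)
  t_naturality f g h := by
    simp only [LinearEquiv.trans_apply, Linear.homCongr_apply, repr_symm_map, ← repr_map]
    simp
  t_γ X Y h := by
    simp only [LinearEquiv.trans_apply, Linear.homCongr_apply, γ_apply,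
      LinearEquiv.symm_apply_apply]
    simp

/-- The dualizing object represents `Y ↦ κ(I, Y)`. -/
def unitPairingEquiv (G : RibbonGVStructure k A) (Y : A) : (G.K ⟶ Y) ≃ G.Pairing (𝟙_ A) Y :=
  (Iso.homCongr (Iso.refl G.K) (λ_ Y).symm).trans (G.repr (𝟙_ A) Y).toEquiv

theorem unitPairingEquiv_comp (G : RibbonGVStructure k A) {Y Y' : A} (h : G.K ⟶ Y) (g : Y ⟶ Y') :
    G.unitPairingEquiv Y' (h ≫ g) = G.pairingMap (𝟙 _) g (G.unitPairingEquiv Y h) := by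
  simp [unitPairingEquiv, ← repr_map]

/-- Equivalent ribbon Grothendieck-Verdier structures have isomorphic dualizing objects. -/
theorem RelEquiv.nonempty_iso {G₁ G₂ : RibbonGVStructure k A} (e : RelEquiv G₁ G₂) :
    Nonempty (G₁.K ≅ G₂.K) := by
  -- At first argument I, the isomorphism `e.t` is a natural bijection between the functors
  -- corepresented by the two dualizing objects; the image of the identity is the Yoneda
  -- isomorphism.
  let E (Y : A) : (G₁.K ⟶ Y) ≃ (G₂.K ⟶ Y) :=
    ((G₁.unitPairingEquiv Y).trans (e.t (𝟙_ A) Y).toEquiv).trans (G₂.unitPairingEquiv Y).symm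
  have hE {Y Y' : A} (h : G₁.K ⟶ Y) (g : Y ⟶ Y') : E Y' (h ≫ g) = E Y h ≫ g := by
    apply (G₂.unitPairingEquiv Y').injective
    rw [unitPairingEquiv_comp]
    simp [E, unitPairingEquiv_comp, e.t_naturality]
  have hE' (Y : A) (h : G₁.K ⟶ Y) : E _ (𝟙 _) ≫ h = E Y h := by simp [← hE]
  have : IsIso (E _ (𝟙 _)) := isIso_of_coyoneda_map_bijective _ fun Y => by
    simpa only [hE'] using (E Y).bijective
  exact ⟨(asIso (E _ (𝟙 _))).symm⟩

/-- Reduces the classification of extensions to deciding which objects occur as K. -/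
theorem equiv_iff_nonempty_iso (G₁ G₂ : RibbonGVStructure k A) :
    G₁ ≈ G₂ ↔ Nonempty (G₁.K ≅ G₂.K) :=
  ⟨fun ⟨e⟩ => e.nonempty_iso, fun ⟨j⟩ => ⟨relEquivOfIso j⟩⟩

end RibbonGVStructure

theorem RibbonGVExtensions.mk_eq_mk_iff (G₁ G₂ : RibbonGVStructure k A) :
    RibbonGVExtensions.mk G₁ = RibbonGVExtensions.mk G₂ ↔ Nonempty (G₁.K ≅ G₂.K) :=
  Quotient.eq.trans (G₁.equiv_iff_nonempty_iso G₂)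

namespace CyclicAutoequiv

/-- The pairing isomorphism of every cyclic autoequivalence `F` arises from an isomorphism `K ≅ F K`. -/
theorem exists_t_eq_pairingIso {G : RibbonGVStructure k A} (Φ : CyclicAutoequiv G) :
    ∃ j : G.K ≅ Φ.functor.obj G.K, ∀ (X Y : A) (h : G.Pairing X Y),
      Φ.t X Y h = pairingIso G Φ.toBalancedAutoequiv j X Y h := by
  -- The isomorphism `Φ.t` at first argument I, rewritten as a bijection from maps out of K to maps
  -- K ⟶ F Y. By naturality it is h ↦ j ≫ F h with j the image of the identity.
  let E (Y : A) : (G.K ⟶ Y) ≃ (G.K ⟶ Φ.functor.obj Y) :=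
    ((G.repr (𝟙_ A) Y).toEquiv.symm.trans (Iso.homCongr (Iso.refl _) (λ_ Y))).symm.trans
      ((Φ.t (𝟙_ A) Y).toEquiv.trans ((G.repr _ _).toEquiv.symm.trans
        (Iso.homCongr (Iso.refl _)
          (whiskerRightIso (Functor.Monoidal.εIso Φ.functor).symm _ ≪≫ λ_ (Φ.functor.obj Y)))))
  have hE_apply (Y : A) (h : G.K ⟶ Y) : E Y h =
      (G.repr _ _).symm (Φ.t _ _ (G.repr _ _ (h ≫ (λ_ Y).inv))) ≫
        η Φ.functor ▷ _ ≫ (λ_ (Φ.functor.obj Y)).hom := by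
    simp [E]
  have hE {Y Y' : A} (h : G.K ⟶ Y) (g : Y ⟶ Y') :
      E Y' (h ≫ g) = E Y h ≫ Φ.functor.map g := by
    have h1 : (h ≫ g) ≫ (λ_ Y').inv = (h ≫ (λ_ Y).inv) ≫ (𝟙 (𝟙_ A) ⊗ₘ g) := by simp
    rw [hE_apply, hE_apply, h1, G.repr_map, Φ.t_naturality, G.repr_symm_map]
    simp [MonoidalCategory.tensorHom_def]
  have hE' (Y : A) (h : G.K ⟶ Y) : E Y h = E _ (𝟙 _) ≫ Φ.functor.map h := by simp [← hE]
  -- Bijectivity of `E` only tests `j` against targets of the form F Y. Essential surjectivity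
  -- replaces an arbitrary target by such an object, and full faithfulness identifies maps F K ⟶ F Y
  -- with maps K ⟶ Y.
  have hbij (Y : A) : Function.Bijective
      fun x : Φ.functor.obj G.K ⟶ Y => E _ (𝟙 _) ≫ x := by
    let i := Φ.functor.objObjPreimageIso Y
    let E' : (Φ.functor.obj G.K ⟶ Y) ≃ (G.K ⟶ Y) :=
      (Iso.homCongr (Iso.refl _) i.symm).trans
        ((Functor.FullyFaithful.ofFullyFaithful Φ.functor).homEquiv.symm.trans
          ((E _).trans (Iso.homCongr (Iso.refl _) i)))
    convert E'.bijective using 2 with x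
    simp [E', hE' (Φ.functor.objPreimage Y), Functor.FullyFaithful.homEquiv]
  have : IsIso (E _ (𝟙 _)) := isIso_of_coyoneda_map_bijective _ hbij
  refine ⟨asIso (E _ (𝟙 _)), fun X Y h => ?_⟩
  obtain ⟨p, rfl⟩ := (G.repr X Y).surjective h
  -- Every element of κ(X, Y) comes through γ from first argument I, so compatibility with γ reduces
  -- the claim to the case already computed by `E`.
  have hγ : G.repr X Y p = G.γ X Y (G.repr _ _ (p ≫ (λ_ _).inv)) := by simp [G.γ_apply]
  rw [pairingIso_apply, LinearEquiv.symm_apply_apply, asIso_hom, ← reassoc_of% hE', hγ, Φ.t_γ,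
    G.γ_apply, G.repr_symm_map, hE_apply]
  simp [MonoidalCategory.tensorHom_def]

theorem mk_eq_mk_ofIso {G : RibbonGVStructure k A} (Φ : CyclicAutoequiv G) :
    ∃ j, CAut.mk Φ = CAut.mk (ofIso G Φ.toBalancedAutoequiv j) := by
  obtain ⟨j, hj⟩ := Φ.exists_t_eq_pairingIso
  refine ⟨j, Quotient.sound ⟨Iso.refl _, inferInstanceAs (NatTrans.IsMonoidal (𝟙 _)), ?_⟩⟩
  exact fun X Y h => (hj X Y h).symm.trans (G.pairingMap_id _).symm

/-- Yoneda again: the element corresponding to K ≅ I ⊗ K is sent to `j` followed by an isomorphism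
that does not depend on `j`. -/
theorem pairingIso_injective (G : RibbonGVStructure k A) (F : BalancedAutoequiv k A)
    {j j' : G.K ≅ F.functor.obj G.K}
    (h : ∀ p : G.Pairing (𝟙_ A) G.K,
      pairingIso G F j (𝟙_ A) G.K p = pairingIso G F j' (𝟙_ A) G.K p) : j = j' := by
  have h1 := h (G.repr _ _ (λ_ G.K).inv)
  rw [pairingIso_apply, pairingIso_apply] at h1
  have h2 := (G.repr _ _).injective h1
  rw [LinearEquiv.symm_apply_apply, ← Category.assoc, ← Category.assoc, cancel_mono,
    cancel_mono] at h2
  exact Iso.ext h2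

end CyclicAutoequiv

end Structures

/-! ### The split exact sequence -/

section Sequence

variable (k : Type w) [Field k] (A : Type u) [Category.{v} A] [Abelian A] [Linear k A]
  [MonoidalCategory A] [MonoidalPreadditive A] [MonoidalLinear k A] [RigidCategory A]
  [BraidedCategory A] [BalancedCategory A] [IsFiniteRibbon k A]

/-- An isomorphism trivializing i(u) is a monoidal automorphism of the identity functor. Its
component at I is the identity, so it cannot absorb `u`. -/
theorem unitToCAut_injective : Function.Injective (unitToCAut k A) := by
  rw [injective_iff_map_eq_one]
  intro u hu
  obtain ⟨e, he, ht⟩ := Quotient.exact (hu.trans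
    (CyclicAutoequiv.mk_ofIso_refl (rigidStructure k A)).symm)
  have he1 : e.hom.app (𝟙_ A) = 𝟙 _ := (Category.id_comp _).symm.trans he.unit
  have h := CyclicAutoequiv.pairingIso_injective (rigidStructure k A) BalancedAutoequiv.refl
    (j := u.symm) (j' := Iso.refl _) fun p => by
      have h1 := ht (𝟙_ A) (𝟙_ A) p
      rw [he1] at h1
      exact (h1.trans ((rigidStructure k A).pairingMap_id _)).symm
  exact congrArg Iso.symm h

theorem forget_comp_ribSection :
    (CAut.forget (rigidStructure k A)).comp (ribSection k A) = MonoidHom.id _ := by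
  ext ⟨F⟩
  rfl

/-- If F is monoidally isomorphic to the identity, the isomorphism I ≅ F I describing the pairing
data can be transported to an automorphism of I. -/
theorem range_unitToCAut :
    (unitToCAut k A).range = (CAut.forget (rigidStructure k A)).ker := by
  refine le_antisymm ?_ ?_
  · rintro _ ⟨u, rfl⟩
    rfl
  · rintro ⟨Φ⟩ hΦ
    obtain ⟨e, he⟩ := Quotient.exact (MonoidHom.mem_ker.mp hΦ)
    obtain ⟨j, hj⟩ := Φ.mk_eq_mk_ofIso
    -- `unitToCAut` passes `u.symm` to `ofIso`, hence the inverse here.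
    refine ⟨(j ≪≫ e.app (𝟙_ A)).symm, Eq.trans ?_ hj.symm⟩
    exact (CyclicAutoequiv.mk_ofIso_congr (rigidStructure k A) Φ.toBalancedAutoequiv
      BalancedAutoequiv.refl j (j ≪≫ e.app (𝟙_ A)) e he rfl).symm

/-- The equivariance needed for `SemidirectProduct.lift`. By `mk_ofIso_mul`, the two sides carry the
isomorphisms (F · u)⁻¹ followed by ε, and ε followed by F(u⁻¹). They agree because the action is F u
conjugated by ε. -/
theorem unitToCAut_unitAction (F : RibAut k A) (u : Aut (𝟙_ A)) :
    unitToCAut k A (RibAut.unitAction F u) * ribSection k A F =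
      ribSection k A F * unitToCAut k A u := by
  obtain ⟨F, rfl⟩ := Quotient.exists_rep F
  refine (CyclicAutoequiv.mk_ofIso_mul (rigidStructure k A) BalancedAutoequiv.refl F
    (RibAut.unitConj F u).symm (Functor.Monoidal.εIso F.functor)).trans
      (Eq.trans ?_ (CyclicAutoequiv.mk_ofIso_mul (rigidStructure k A) F BalancedAutoequiv.refl
        (Functor.Monoidal.εIso F.functor) u.symm).symm)
  refine CyclicAutoequiv.mk_ofIso_congr _ _ _ _ _ (F.functor.rightUnitor ≪≫ F.functor.leftUnitor.symm)
    (inferInstanceAs (NatTrans.IsMonoidal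
      (F.functor.rightUnitor.hom ≫ F.functor.leftUnitor.inv))) ?_
  have h : (RibAut.unitConj F u).inv = ε F.functor ≫ F.functor.map u.inv ≫ η F.functor :=
    (congrArg Iso.hom (map_inv (RibAut.unitConj F) u)).symm.trans (RibAut.unitConj_hom F u⁻¹)
  change ((RibAut.unitConj F u).inv ≫ ε F.functor) ≫ 𝟙 _ ≫ 𝟙 _ = ε F.functor ≫ F.functor.map u.inv
  simp [h]

/-- The homomorphism `Aut(I) ⋊ RibAut(A) → cAut(A)`, `(u, F) ↦ i(u) s(F)`. -/
noncomputable def semidirectToCAut :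
    Aut (𝟙_ A) ⋊[RibAut.unitAction (k := k)] RibAut k A →* CAut (rigidStructure k A) :=
  SemidirectProduct.lift (unitToCAut k A) (ribSection k A) fun F => by
    ext u
    exact eq_mul_inv_of_mul_eq (unitToCAut_unitAction k A F u)

theorem semidirectToCAut_apply (x : Aut (𝟙_ A) ⋊[RibAut.unitAction (k := k)] RibAut k A) :
    semidirectToCAut k A x = unitToCAut k A x.left * ribSection k A x.right := rfl

theorem forget_semidirectToCAut
    (x : Aut (𝟙_ A) ⋊[RibAut.unitAction (k := k)] RibAut k A) :
    CAut.forget (rigidStructure k A) (semidirectToCAut k A x) = x.right := by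
  have h1 : CAut.forget (rigidStructure k A) (unitToCAut k A x.left) = 1 := rfl
  have h2 := DFunLike.congr_fun (forget_comp_ribSection k A) x.right
  rw [semidirectToCAut_apply, map_mul, h1, one_mul]
  exact h2

theorem semidirectToCAut_bijective : Function.Bijective (semidirectToCAut k A) := by
  constructor
  · rw [injective_iff_map_eq_one]
    intro x hx
    have hr : x.right = 1 := by rw [← forget_semidirectToCAut, hx, map_one]
    have hl : unitToCAut k A x.left = 1 := by
      rwa [semidirectToCAut_apply, hr, map_one, mul_one] at hx
    exact SemidirectProduct.ext
      (unitToCAut_injective k A (hl.trans (map_one _).symm)) hr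
  · intro y
    -- Dividing `y` by the section of its image leaves an element of the kernel, hence some i(u).
    have hy : y * (ribSection k A (CAut.forget _ y))⁻¹ ∈ (CAut.forget (rigidStructure k A)).ker := by
      have h := DFunLike.congr_fun (forget_comp_ribSection k A) (CAut.forget _ y)
      rw [MonoidHom.comp_apply, MonoidHom.id_apply] at h
      rw [MonoidHom.mem_ker, map_mul, map_inv, h, mul_inv_cancel]
    rw [← range_unitToCAut] at hy
    obtain ⟨u, hu⟩ := hy
    refine ⟨⟨u, CAut.forget _ y⟩, ?_⟩
    rw [semidirectToCAut_apply]
    exact eq_mul_inv_iff_mul_eq.mp hu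

/-- The isomorphism `cAut(A) ≅ Aut(I) ⋊ RibAut(A)`. -/
noncomputable def cAutMulEquiv :
    CAut (rigidStructure k A) ≃* Aut (𝟙_ A) ⋊[RibAut.unitAction (k := k)] RibAut k A :=
  (MulEquiv.ofBijective _ (semidirectToCAut_bijective k A)).symm

theorem cAutMulEquiv_unitToCAut (u : Aut (𝟙_ A)) :
    cAutMulEquiv k A (unitToCAut k A u) = SemidirectProduct.inl u :=
  (MulEquiv.symm_apply_eq _).mpr <| by
    simp [semidirectToCAut_apply]

theorem cAutMulEquiv_ribSection (F : RibAut k A) :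
    cAutMulEquiv k A (ribSection k A F) = SemidirectProduct.inr F :=
  (MulEquiv.symm_apply_eq _).mpr <| by
    simp [semidirectToCAut_apply]

theorem cAutMulEquiv_right (y : CAut (rigidStructure k A)) :
    (cAutMulEquiv k A y).right = CAut.forget (rigidStructure k A) y := by
  obtain ⟨x, rfl⟩ := (cAutMulEquiv k A).symm.surjective y
  rw [MulEquiv.apply_symm_apply]
  exact (forget_semidirectToCAut k A x).symm

end Sequence

/-! ### Invertible objects and the balanced Müger center -/

section Tensor

variable {A : Type u} [Category.{v} A] [MonoidalCategory A]

/-- Tensoring with an object that has a two-sided inverse is an equivalence. -/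
theorem isEquivalence_tensorRight {L M : A} (i : L ⊗ M ≅ 𝟙_ A) (j : M ⊗ L ≅ 𝟙_ A) :
    (tensorRight L).IsEquivalence :=
  (CategoryTheory.Equivalence.mk (tensorRight L) (tensorRight M)
    ((rightUnitorNatIso A).symm ≪≫ (tensoringRight A).mapIso i.symm ≪≫ tensorRightTensor L M)
    ((tensorRightTensor M L).symm ≪≫ (tensoringRight A).mapIso j ≪≫
      rightUnitorNatIso A)).isEquivalence_functor

variable [BraidedCategory A] [BalancedCategory A]

theorem θ_naturality {X Y : A} (f : X ⟶ Y) : f ≫ θ Y = θ X ≫ f :=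
  BalancedCategory.twist_naturality f

theorem θ_tensor (X Y : A) :
    θ (X ⊗ Y) = (θ X ⊗ₘ θ Y) ≫ (β_ X Y).hom ≫ (β_ Y X).hom :=
  BalancedCategory.twist_tensor X Y

instance : (balancedMugerCenter A).IsClosedUnderIsomorphisms where
  of_iso {X X'} e hX := by
    refine ⟨fun Y => ?_, ?_⟩
    · rw [← cancel_epi (e.hom ▷ Y), BraidedCategory.braiding_naturality_left_assoc,
        BraidedCategory.braiding_naturality_right, reassoc_of% hX.1 Y]
      simp
    · rw [← cancel_epi e.hom, θ_naturality, hX.2]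
      simp

/-- An inverse of an object of the balanced Müger center lies in the balanced Müger center. -/
theorem balancedMugerCenter_of_tensor_iso_unit {L M : A} (hL : balancedMugerCenter A L)
    (i : L ⊗ M ≅ 𝟙_ A) : balancedMugerCenter A M := by
  have hLM : balancedMugerCenter A (L ⊗ M) :=
    (balancedMugerCenter A).prop_of_iso i.symm (balancedMugerCenter A).prop_unit
  -- Since L is invertible, L ⊗ - is faithful, so both conditions on M may be tested after tensoring
  -- with L.
  have : (tensorRight L).IsEquivalence := isEquivalence_tensorRight i ((β_ M L) ≪≫ i)
  have : (tensorLeft L).Faithful :=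
    Functor.Faithful.of_iso (BraidedCategory.tensorLeftIsoTensorRight L).symm
  refine ⟨fun Y => (tensorLeft L).map_injective ?_, (tensorLeft L).map_injective ?_⟩
  -- By the hexagons, the double braiding of L ⊗ M with Y contains that of L with Y in its middle.
  -- The latter cancels, leaving L tensored with the double braiding of M and Y.
  · have h := hLM.1 Y
    have h1 : (β_ L Y).hom ▷ M ≫ (β_ Y L).hom ▷ M = 𝟙 _ := by
      rw [← comp_whiskerRight, hL.1 Y, id_whiskerRight]
    simp only [BraidedCategory.braiding_tensor_left_hom,
      BraidedCategory.braiding_tensor_right_hom, Category.assoc, Iso.hom_inv_id_assoc,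
      Iso.inv_hom_id_assoc, reassoc_of% h1] at h
    rw [← cancel_epi (α_ L M Y).hom, ← cancel_mono (α_ L M Y).inv]
    simpa using h
  · have h := hLM.2
    rw [θ_tensor, hL.1 M, Category.comp_id] at h
    simpa [hL.2] using h

/-- The double braiding is trivial in either order, by conjugation with the braiding. For X a dual,
this gives the ribbon condition on D X = X^∨ ⊗ L. -/
theorem θ_tensor_of_mem (X : A) {L : A} (hL : balancedMugerCenter A L) :
    θ (X ⊗ L) = θ X ▷ L := by
  have h : (β_ X L).hom ≫ (β_ L X).hom = 𝟙 _ := by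
    rw [← cancel_mono (β_ X L).hom, Category.assoc, hL.1 X]
    simp
  rw [θ_tensor, h, Category.comp_id, hL.2, MonoidalCategory.tensorHom_id]

end Tensor

/-! ### Dualizing objects in a rigid category -/

section Dualizing

variable {k : Type w} [Field k] {A : Type u} [Category.{v} A] [Abelian A] [Linear k A]
  [MonoidalCategory A] [MonoidalPreadditive A] [MonoidalLinear k A] [RigidCategory A]

variable (k) in
/-- The isomorphism `A(K, X ⊗ Y) ≅ A(X^∨ ⊗ K, Y)`. -/
def tensorDualHomEquiv (K X Y : A) : (K ⟶ X ⊗ Y) ≃ₗ[k] ((Xᘁ : A) ⊗ K ⟶ Y) :=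
  LinearEquiv.symm
    { tensorLeftHomEquiv K X (Xᘁ) Y with
      map_add' f g := by simp [tensorLeftHomEquiv]
      map_smul' a f := by simp [tensorLeftHomEquiv] }

theorem tensorDualHomEquiv_symm_apply (K X Y : A) (p : (Xᘁ : A) ⊗ K ⟶ Y) :
    (tensorDualHomEquiv k K X Y).symm p =
      (λ_ K).inv ≫ η_ X (Xᘁ) ▷ K ≫ (α_ _ _ _).hom ≫ X ◁ p := rfl

/-- Naturality in X is the dinaturality of coevaluation, tensored with K. -/
theorem tensorDualHomEquiv_naturality (K : A) {X X' Y Y' : A} (f : X ⟶ X') (g : Y ⟶ Y')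
    (h : K ⟶ X ⊗ Y) :
    tensorDualHomEquiv k K X' Y' (h ≫ (f ⊗ₘ g)) =
      ((fᘁ) ▷ K) ≫ tensorDualHomEquiv k K X Y h ≫ g := by
  obtain ⟨p, rfl⟩ := (tensorDualHomEquiv k K X Y).symm.surjective h
  rw [← LinearEquiv.eq_symm_apply, LinearEquiv.apply_symm_apply, tensorDualHomEquiv_symm_apply,
    tensorDualHomEquiv_symm_apply]
  have h1 := congrArg (fun q => q ▷ K ≫ (α_ _ _ _).hom) (coevaluation_comp_rightAdjointMate f)
  simp only [comp_whiskerRight, Category.assoc, associator_naturality_middle,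
    associator_naturality_left] at h1
  rw [MonoidalCategory.whiskerLeft_comp, reassoc_of% h1, MonoidalCategory.tensorHom_def]
  simp only [Category.assoc, whisker_exchange_assoc, MonoidalCategory.whiskerLeft_comp]

variable [BraidedCategory A] [BalancedCategory A]

/-- The ribbon Grothendieck-Verdier structure with dualizing object `L` and `D X = X^∨ ⊗ L`, for an
invertible object `L` of the balanced Müger center. -/
def structureOfInvertible [IsFiniteRibbon k A] {L M : A} (hL : balancedMugerCenter A L)
    (i : L ⊗ M ≅ 𝟙_ A) : RibbonGVStructure k A where
  K := L
  D := dualFunctor A ⋙ (tensorRight L).op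
  isEquivalence :=
    have := isEquivalence_tensorRight i ((β_ M L) ≪≫ i)
    inferInstance
  repr := tensorDualHomEquiv k L
  repr_naturality f g h := tensorDualHomEquiv_naturality L f g h
  twist_D X := (θ_tensor_of_mem _ hL).trans
    (congrArg (· ▷ L) (IsFiniteRibbon.twist_dual k X))

namespace RibbonGVStructure

/-- D X and X^∨ ⊗ K corepresent the same functor Y ↦ A(K, X ⊗ Y). This and the next lemma are the
two halves of the Yoneda comparison and make the maps in `dualIso` mutually inverse. -/
theorem repr_tensorDualHomEquiv_symm (G : RibbonGVStructure k A) {X Y : A}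
    (p : (Xᘁ : A) ⊗ G.K ⟶ Y) :
    G.repr X Y ((tensorDualHomEquiv k G.K X Y).symm p) =
      G.repr X _ ((tensorDualHomEquiv k G.K X _).symm (𝟙 _)) ≫ p := by
  have h := G.repr_naturality (𝟙 X) p ((tensorDualHomEquiv k G.K X _).symm (𝟙 _))
  simpa [tensorDualHomEquiv_symm_apply] using h

theorem tensorDualHomEquiv_repr_symm (G : RibbonGVStructure k A) {X Y : A}
    (q : G.Pairing X Y) :
    tensorDualHomEquiv k G.K X Y ((G.repr X Y).symm q) =
      tensorDualHomEquiv k G.K X _ ((G.repr X _).symm (𝟙 _)) ≫ q := by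
  have h := tensorDualHomEquiv_naturality (k := k) G.K (𝟙 X) q ((G.repr X _).symm (𝟙 _))
  rw [← repr_symm_map] at h
  simpa [pairingMap] using h

/-- In a rigid category, the duality functor is `D X ≅ X^∨ ⊗ K`. -/
def dualIso (G : RibbonGVStructure k A) (X : A) : (G.D.obj X).unop ≅ (Xᘁ : A) ⊗ G.K where
  hom := G.repr X _ ((tensorDualHomEquiv k G.K X _).symm (𝟙 _))
  inv := tensorDualHomEquiv k G.K X _ ((G.repr X _).symm (𝟙 _))
  hom_inv_id := by simp [← repr_tensorDualHomEquiv_symm]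
  inv_hom_id := by simp [← tensorDualHomEquiv_repr_symm]

/-- Both sides are the image under `repr` of the universal element composed with f. This carries the
condition θ_{DX} = D θ_X over to X^∨ ⊗ K. -/
theorem dualIso_naturality (G : RibbonGVStructure k A) {X X' : A} (f : X ⟶ X') :
    (G.D.map f).unop ≫ (G.dualIso X).hom = (G.dualIso X').hom ≫ fᘁ ▷ G.K := by
  have h := G.repr_naturality f (𝟙 _) ((tensorDualHomEquiv k G.K X _).symm (𝟙 _))
  have h1 := tensorDualHomEquiv_naturality (k := k) G.K f (𝟙 _)
    ((tensorDualHomEquiv k G.K X _).symm (𝟙 _))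
  rw [← LinearEquiv.eq_symm_apply] at h1
  rw [h1, repr_tensorDualHomEquiv_symm] at h
  simpa [dualIso] using h.symm

/-- Essential surjectivity of D gives X with I ≅ D X ≅ X^∨ ⊗ K, so X^∨ is an inverse of K. -/
theorem exists_tensor_K_iso (G : RibbonGVStructure k A) : ∃ M : A, Nonempty (G.K ⊗ M ≅ 𝟙_ A) := by
  have := G.isEquivalence
  let X := G.D.objPreimage (Opposite.op (𝟙_ A))
  exact ⟨Xᘁ, ⟨β_ _ _ ≪≫ (G.dualIso X).symm ≪≫
    (G.D.objObjPreimageIso (Opposite.op (𝟙_ A))).symm.unop⟩⟩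

/-- Along `dualIso` the ribbon condition becomes θ_{Y ⊗ K} = θ_Y ⊗ id, first for duals and then for
all Y. Cancelling θ_Y in the balancing formula leaves θ_K followed by the double braiding equal to
the identity. The case Y = I separates the two factors: braidings with I contribute nothing, so θ_K
= id. -/
theorem K_mem_balancedMugerCenter [IsFiniteRibbon k A] (G : RibbonGVStructure k A) :
    balancedMugerCenter A G.K := by
  have h1 (X : A) : θ ((Xᘁ : A) ⊗ G.K) = θ (Xᘁ) ▷ G.K := by
    rw [← cancel_epi (G.dualIso X).hom, θ_naturality, G.twist_D,
      G.dualIso_naturality, IsFiniteRibbon.twist_dual k X]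
  have h2 (Y : A) : θ (Y ⊗ G.K) = θ Y ▷ G.K := by
    let i := ((dualFunctor A).objObjPreimageIso (Opposite.op Y)).unop
    change Y ≅ ((dualFunctor A).objPreimage (Opposite.op Y))ᘁ at i
    rw [← cancel_mono (i.hom ▷ G.K), ← comp_whiskerRight, ← θ_naturality, ← θ_naturality, h1,
      comp_whiskerRight]
  have h3 (Y : A) : Y ◁ θ G.K ≫ (β_ Y G.K).hom ≫ (β_ G.K Y).hom = 𝟙 _ := by
    have h := h2 Y
    rw [θ_tensor, MonoidalCategory.tensorHom_def, Category.assoc] at h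
    rw [← cancel_epi ((BalancedCategory.twist Y).hom ▷ G.K), h, Category.comp_id]
  have h4 : θ G.K = 𝟙 _ := by
    have h := h3 (𝟙_ A)
    rw [← cancel_epi (λ_ G.K).hom, ← cancel_mono (λ_ G.K).inv]
    simpa [braiding_tensorUnit_left, braiding_tensorUnit_right] using h
  refine ⟨fun Y => ?_, h4⟩
  have h := h3 Y
  rw [h4, MonoidalCategory.whiskerLeft_id, Category.id_comp] at h
  rw [← cancel_epi (β_ Y G.K).hom, reassoc_of% h, Category.comp_id]

end RibbonGVStructure

end Dualizing

/-! ### The classification of extensions by the Picard group -/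

section Classification

variable (k : Type w) [Field k] (A : Type u) [Category.{v} A] [Abelian A] [Linear k A]
  [MonoidalCategory A] [MonoidalPreadditive A] [MonoidalLinear k A] [RigidCategory A]
  [BraidedCategory A] [BalancedCategory A] [IsFiniteRibbon k A]

variable {A} in
/-- Every invertible object of the balanced Müger center is a dualizing object. -/
theorem exists_structure_of_pic (x : Pic (BalancedMugerCenter A)) :
    ∃ G : RibbonGVStructure k A,
      Nonempty (G.K ≅ ((fromSkeleton (BalancedMugerCenter A)).obj x.val).obj) := by
  let L := (fromSkeleton (BalancedMugerCenter A)).obj x.val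
  let M := (fromSkeleton (BalancedMugerCenter A)).obj x.inv
  -- The product in `Skeleton` is computed on representatives, so x x⁻¹ = 1 is this equation and
  -- yields an isomorphism L ⊗ M ≅ I.
  have h : toSkeleton (L ⊗ M) = toSkeleton (𝟙_ (BalancedMugerCenter A)) := x.val_inv
  let i := (balancedMugerCenter A).ι.mapIso (Skeleton.isoOfEq h)
  exact ⟨structureOfInvertible (k := k) (M := M.obj) L.property i, ⟨Iso.refl _⟩⟩

variable {k A} in
/-- Every dualizing object is an invertible object of the balanced Müger center. -/
theorem RibbonGVStructure.exists_pic (G : RibbonGVStructure k A) :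
    ∃ x : Pic (BalancedMugerCenter A),
      Nonempty (G.K ≅ ((fromSkeleton (BalancedMugerCenter A)).obj x.val).obj) := by
  obtain ⟨M, ⟨i⟩⟩ := G.exists_tensor_K_iso
  have hK := G.K_mem_balancedMugerCenter
  let L' : BalancedMugerCenter A := ⟨G.K, hK⟩
  let M' : BalancedMugerCenter A := ⟨M, balancedMugerCenter_of_tensor_iso_unit hK i⟩
  let x : Pic (BalancedMugerCenter A) :=
    { val := toSkeleton L'
      inv := toSkeleton M'
      val_inv := by
        rw [← Skeleton.toSkeleton_tensorObj]
        exact congr_toSkeleton_of_iso ((balancedMugerCenter A).isoMk i)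
      inv_val := by
        rw [← Skeleton.toSkeleton_tensorObj]
        exact congr_toSkeleton_of_iso ((balancedMugerCenter A).isoMk (β_ M G.K ≪≫ i)) }
  exact ⟨x, ⟨(balancedMugerCenter A).ι.mapIso (fromSkeletonToSkeletonIso L').symm⟩⟩

/-- The extension whose dualizing object is a given invertible object of the balanced Müger
center. -/
noncomputable def picToExtensions (x : Pic (BalancedMugerCenter A)) : RibbonGVExtensions k A :=
  RibbonGVExtensions.mk (exists_structure_of_pic k x).choose

-- The class of an extension depends only on K up to isomorphism, so the choice made in
-- `picToExtensions` is harmless.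
variable {A} in
theorem picToExtensions_eq_mk_iff (x : Pic (BalancedMugerCenter A)) (L : BalancedMugerCenter A)
    (G : RibbonGVStructure k A) (hx : (x : Skeleton (BalancedMugerCenter A)) = toSkeleton L) :
    picToExtensions k A x = RibbonGVExtensions.mk G ↔ Nonempty (G.K ≅ L.obj) := by
  obtain ⟨i⟩ := (exists_structure_of_pic k x).choose_spec
  obtain ⟨j⟩ := toSkeleton_eq_iff.mp hx.symm
  let j' := (balancedMugerCenter A).ι.mapIso j
  rw [picToExtensions, RibbonGVExtensions.mk_eq_mk_iff]
  exact ⟨fun ⟨e⟩ => ⟨e.symm ≪≫ i ≪≫ j'.symm⟩, fun ⟨e⟩ => ⟨i ≪≫ j'.symm ≪≫ e.symm⟩⟩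

theorem picToExtensions_bijective : Function.Bijective (picToExtensions k A) := by
  constructor
  · intro x y h
    obtain ⟨i⟩ := (exists_structure_of_pic k y).choose_spec
    obtain ⟨e⟩ := (picToExtensions_eq_mk_iff k x _ _
      (toSkeleton_fromSkeleton_obj x.val).symm).mp h
    refine Units.ext ?_
    rw [← toSkeleton_fromSkeleton_obj x.val, ← toSkeleton_fromSkeleton_obj y.val]
    -- The isomorphism of dualizing objects lives in A; it lifts because the balanced Müger center
    -- is a full subcategory.
    exact congr_toSkeleton_of_iso ((balancedMugerCenter A).isoMk (e.symm ≪≫ i))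
  · rintro ⟨G⟩
    obtain ⟨x, hx⟩ := G.exists_pic
    exact ⟨x, (picToExtensions_eq_mk_iff k x _ G (toSkeleton_fromSkeleton_obj x.val).symm).mpr hx⟩

end Classification

end GV

theorem mainTheorem8 (k : Type w) [Field k] [IsAlgClosed k]
    (A : Type u) [Category.{v} A] [Abelian A] [Linear k A]
    [MonoidalCategory A] [MonoidalPreadditive A] [MonoidalLinear k A] [RigidCategory A]
    [BraidedCategory A] [GV.BalancedCategory A] [GV.IsFiniteRibbon k A] :
    (∃ e : GV.Pic (GV.BalancedMugerCenter A) ≃ GV.RibbonGVExtensions k A,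
      e 1 = GV.RibbonGVExtensions.mk (GV.rigidStructure k A) ∧
      ∀ (x : GV.Pic (GV.BalancedMugerCenter A)) (L : GV.BalancedMugerCenter A)
        (G : GV.RibbonGVStructure k A), (x : Skeleton (GV.BalancedMugerCenter A)) = toSkeleton L →
          (e x = GV.RibbonGVExtensions.mk G ↔ Nonempty (G.K ≅ L.obj))) ∧
    (Function.Injective (GV.unitToCAut k A) ∧
      (GV.unitToCAut k A).range = (GV.CAut.forget (GV.rigidStructure k A)).ker ∧
      (GV.CAut.forget (GV.rigidStructure k A)).comp (GV.ribSection k A) = MonoidHom.id _) ∧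
    ∃ Φ : GV.CAut (GV.rigidStructure k A) ≃*
        Aut (𝟙_ A) ⋊[GV.RibAut.unitAction (k := k)] GV.RibAut k A,
      (∀ u, Φ (GV.unitToCAut k A u) = SemidirectProduct.inl u) ∧
      (∀ F, Φ (GV.ribSection k A F) = SemidirectProduct.inr F) ∧
      (∀ y, (Φ y).right = GV.CAut.forget (GV.rigidStructure k A) y) := by
  refine ⟨⟨Equiv.ofBijective _ (GV.picToExtensions_bijective k A), ?_,
      GV.picToExtensions_eq_mk_iff k⟩,
    ⟨GV.unitToCAut_injective k A, GV.range_unitToCAut k A, GV.forget_comp_ribSection k A⟩,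
    GV.cAutMulEquiv k A, GV.cAutMulEquiv_unitToCAut k A, GV.cAutMulEquiv_ribSection k A,
    GV.cAutMulEquiv_right k A⟩
  -- The neutral element is represented by I, which is the dualizing object of the rigid structure.
  exact (GV.picToExtensions_eq_mk_iff k 1 (𝟙_ _) (GV.rigidStructure k A) rfl).mpr ⟨Iso.refl _⟩
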